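/- Let $X$ be a real Banach space with continuous dual $X^*$ and pairing $\langle\cdot,\cdot\rangle$. Let $A\colon X\rightrightarrows X^*$ be a set-valued operator, with graph $\operatorname{gra}A=\{(x,x^*)\in X\times X^* : x^*\in Ax\}$ and domain $\operatorname{dom}A=\{x\in X : Ax\neq\varnothing\}$. Suppose that $A$ is maximally monotone, that is, $\langle x-y,x^*-y^*\rangle\ge 0$ for all $(x,x^*),(y,y^*)\in\operatorname{gra}A$, and $A$ has no proper monotone extension in the sense of graph inclusion. Suppose that $\operatorname{int}\operatorname{dom}A\neq\varnothing$, and let $S\subseteq\operatorname{int}\operatorname{dom}A$ be norm dense in $\operatorname{int}\operatorname{dom}A$. Then, for every $x\in X$, $$Ax \;=\; N_{\overline{\operatorname{dom}A}}(x)+\overline{\operatorname{conv}\,[A_S(x)]}^{\,\mathrm{w}^*}\;=\;\operatorname{rec}A(x)+\overline{\operatorname{conv}\,[A_S(x)]}^{\,\mathrm{w}^*}.$$ Here $\overline{C}$ denotes the norm closure of $C\subseteq X$ and $\overline{D}^{\,\mathrm{w}^*}$ the weak$^*$ closure of $D\subseteq X^*$; a sum of sets is the Minkowski sum, which is empty if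 one of the summands is; $A_S\colon X\rightrightarrows X^*$ is the operator whose graph is the norm $\times$ weak$^*$ closure of $\operatorname{gra}A\cap(S\times X^*)$; the normal cone of $C\subseteq X$ is $N_C(x)=\{x^*\in X^* : \langle c-x,x^*\rangle\le 0 \text{ for all } c\in C\}$ if $x\in C$, and $N_C(x)=\varnothing$ if $x\notin C$; and $\operatorname{rec}A(x)$ is the set of all $x^*\in X^*$ for which there are a sequence of reals $t_n>0$ with $t_n\to 0$ and a sequence $(a_n,a_n^*)$ in $\operatorname{gra}A$ such that $a_n\to x$ in norm and $t_na_n^*\to x^*$ in the weak$^*$ topology. -/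

import Mathlib

open scoped Topology Pointwise

/-!
Set-valued operators from a real normed space `X` to its continuous dual are functions
`A : X → Set (StrongDual ℝ X)`; the pairing of `x` with `f` is `f x`.
The weak* topology is the topology of `WeakDual ℝ X`.
-/

namespace SetValuedOp

variable {X : Type*} [NormedAddCommGroup X] [NormedSpace ℝ X]

/-- The graph `{(x, f) | f ∈ A x}`. -/
def graph (A : X → Set (StrongDual ℝ X)) : Set (X × StrongDual ℝ X) :=
  {p | p.2 ∈ A p.1}

/-- The domain `{x | A x ≠ ∅}`. -/
def dom (A : X → Set (StrongDual ℝ X)) : Set X :=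
  {x | (A x).Nonempty}

/-- Monotonicity: `⟨x - y, f - g⟩ ≥ 0` for all `(x, f)`, `(y, g)` in the graph. -/
def IsMonotone (A : X → Set (StrongDual ℝ X)) : Prop :=
  ∀ p ∈ graph A, ∀ q ∈ graph A, 0 ≤ (p.2 - q.2) (p.1 - q.1)

/-- Maximal monotonicity: monotone, and every monotone operator whose graph contains that of `A`
equals `A`. -/
def IsMaximallyMonotone (A : X → Set (StrongDual ℝ X)) : Prop :=
  IsMonotone A ∧
    ∀ B : X → Set (StrongDual ℝ X), IsMonotone B → graph A ⊆ graph B → B = A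

/-- The weak* closure of a subset of the dual. -/
def weakStarClosure (D : Set (StrongDual ℝ X)) : Set (StrongDual ℝ X) :=
  {f | StrongDual.toWeakDual f ∈ closure ((StrongDual.toWeakDual : _ → WeakDual ℝ X) '' D)}

/-- The norm × weak* closure of a subset of `X × X*`. -/
def normWeakStarClosure (G : Set (X × StrongDual ℝ X)) : Set (X × StrongDual ℝ X) :=
  {p | (p.1, StrongDual.toWeakDual p.2) ∈
    closure ((fun q : X × StrongDual ℝ X =>
      ((q.1, StrongDual.toWeakDual q.2) : X × WeakDual ℝ X)) '' G)}

/-- The operator `A_S`, whose graph is the norm × weak* closure of the graph of `A`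
restricted to `S`. -/
def closedRestriction (A : X → Set (StrongDual ℝ X)) (S : Set X) :
    X → Set (StrongDual ℝ X) :=
  fun x => {f | (x, f) ∈ normWeakStarClosure (graph A ∩ (S ×ˢ Set.univ))}

/-- The normal cone of `C` at `x`, empty if `x ∉ C`. -/
def normalCone (C : Set X) (x : X) : Set (StrongDual ℝ X) :=
  {f | x ∈ C ∧ ∀ c ∈ C, f (c - x) ≤ 0}

/-- The recession cone of `A` at `x`: all weak* limits of sequences `tₙ • fₙ` with
`tₙ → 0⁺`, `(aₙ, fₙ)` in the graph of `A`, and `aₙ → x` in norm. -/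
def recessionCone (A : X → Set (StrongDual ℝ X)) (x : X) : Set (StrongDual ℝ X) :=
  {f | ∃ (t : ℕ → ℝ) (a : ℕ → X) (g : ℕ → StrongDual ℝ X),
    (∀ n, 0 < t n) ∧ Filter.Tendsto t Filter.atTop (𝓝 0) ∧
    (∀ n, (a n, g n) ∈ graph A) ∧
    Filter.Tendsto a Filter.atTop (𝓝 x) ∧
    Filter.Tendsto (fun n => (StrongDual.toWeakDual (t n • g n) : WeakDual ℝ X))
      Filter.atTop (𝓝 (StrongDual.toWeakDual f))}

end SetValuedOp

/-!
Write `D` for the domain of `A`, `U` for its interior and `N` for the normal cone of the closure of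
`D` at `x`.

Everything rests on one growth estimate. By monotonicity each `z ∈ D` satisfies
`g (z - y) ≤ K (1 + ‖y‖)` on the graph for some `K`, and for fixed `K` the set of such `z`
(`growthSet`) is closed and convex. The Baire category theorem gives a ball on which a single `K`
works, and convexity moves this ball to any interior point of the convex hull of `D`
(`IsMonotone.exists_ball_subset_growthSet_of_mem_interior`). Whenever the values of a net in the
graph are known to be bounded from one side in one direction pointing to the centre of such a ball,
the estimate bounds their norms, and Banach–Alaoglu applies. Three facts follow.

* The interior of the convex hull of `D` is `U`
  (`IsMaximallyMonotone.interior_convexHull_dom`), by a Hahn–Banach separation in `X × ℝ`; so `U`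
  is convex and dense in `D`.
* The graph is norm × weak* closed (`IsMaximallyMonotone.mem_of_tendsto`), since weak* convergence
  itself provides the one-sided bound. Hence the weak* closed convex hull `E` of `A_S x` lies in
  `A x`, and so does `N + E`.
* If `v` points from `x ∈ D` into `U`, then every `f ∈ A x` satisfies `f v ≤ g v` for some
  `g ∈ A_S x` (`IsMaximallyMonotone.exists_mem_closedRestriction`): take a limit of values of
  `A` at points of `S` that approach `x` in the direction `v`; monotonicity bounds them in the
  direction `v`.

The set `N + E` is weak* closed (`weakStarClosure_normalCone_add_subset`). If `f ∈ A x` were outside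
it, some `v` would separate them strictly, and `v` would be nonpositive on the cone `N`. Such a `v`
is a limit of directions pointing into `U` (`exists_add_smul_mem_of_normalCone_nonpos`), so the third
fact contradicts the separation. Finally the recession cone at a point of `D` is `N`: scaling
`f + m n ∈ A x` gives one inclusion, and the uniform boundedness principle the other. Off `D`
both sides of the formula are empty because `E ⊆ A x`.
-/

open Filter Set

namespace SetValuedOp

section

variable {X : Type*} [NormedAddCommGroup X] [NormedSpace ℝ X]

/-! ### Bounded nets and the weak* topology -/

lemma norm_le_of_forall_ball {f : StrongDual ℝ X} {δ B : ℝ} (hδ : 0 < δ)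
    (h : ∀ w, ‖w‖ < δ → f w ≤ B) : ‖f‖ ≤ 2 * B / δ := by
  have hB : 0 ≤ B := by simpa using h 0 (by simpa using hδ)
  refine f.opNorm_le_of_shell (ε := δ) (c := (2 : ℝ)) hδ (by positivity) (by norm_num) ?_
  intro w h1 h2
  have h3 : |f w| ≤ B := abs_le'.2 ⟨h w h2, by simpa using h (-w) (by simpa using h2)⟩
  rw [Real.norm_eq_abs]
  refine h3.trans ?_
  rw [Real.norm_eq_abs, abs_of_pos (by norm_num : (0 : ℝ) < 2)] at h1
  rw [div_mul_eq_mul_div, le_div_iff₀ hδ]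
  nlinarith

/-- The pairing is continuous along bounded nets of functionals converging pointwise and
norm convergent nets of points. -/
lemma tendsto_apply_of_bounded {ι : Type*} {l : Filter ι} {φ : ι → StrongDual ℝ X} {y : ι → X}
    {y₀ : X} {a M : ℝ} (hb : ∀ᶠ i in l, ‖φ i‖ ≤ M) (hy : Tendsto y l (𝓝 y₀))
    (hφ : Tendsto (fun i => φ i y₀) l (𝓝 a)) : Tendsto (fun i => φ i (y i)) l (𝓝 a) := by
  have h0 : Tendsto (fun i => φ i (y i - y₀)) l (𝓝 0) := by
    have h1 : Tendsto (fun i => M * ‖y i - y₀‖) l (𝓝 0) := by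
      have := ((hy.sub_const y₀).norm).const_mul M
      simpa using this
    refine squeeze_zero_norm' ?_ h1
    filter_upwards [hb] with i hi
    exact (φ i).le_of_opNorm_le hi _
  have := h0.add hφ
  simpa using this

/-- A bounded net in the dual has a pointwise limit along any ultrafilter (Banach–Alaoglu). -/
lemma exists_tendsto_of_bounded {ι : Type*} (u : Ultrafilter ι) {φ : ι → StrongDual ℝ X} {M : ℝ}
    (hb : ∀ᶠ i in (u : Filter ι), ‖φ i‖ ≤ M) :
    ∃ g : StrongDual ℝ X,
      Tendsto (fun i => StrongDual.toWeakDual (φ i)) u (𝓝 (StrongDual.toWeakDual g)) := by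
  have hc := WeakDual.isCompact_closedBall (𝕜 := ℝ) (0 : StrongDual ℝ X) M
  obtain ⟨g, -, hg⟩ := hc.ultrafilter_le_nhds (u.map fun i => StrongDual.toWeakDual (φ i)) (by
    rw [le_principal_iff]
    change _ ∈ map _ _
    rw [mem_map]
    filter_upwards [hb] with i hi
    simpa using hi)
  exact ⟨WeakDual.toStrongDual g, hg⟩

lemma tendsto_eval {ι : Type*} {l : Filter ι} {φ : ι → WeakDual ℝ X} {g : WeakDual ℝ X}
    (h : Tendsto φ l (𝓝 g)) (x : X) : Tendsto (fun i => φ i x) l (𝓝 (g x)) :=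
  ((WeakDual.eval_continuous x).tendsto g).comp h

lemma mem_weakStarClosure {D : Set (StrongDual ℝ X)} {f : StrongDual ℝ X} :
    f ∈ weakStarClosure D ↔ StrongDual.toWeakDual f ∈
      closure ((StrongDual.toWeakDual : _ → WeakDual ℝ X) '' D) :=
  Iff.rfl

lemma subset_weakStarClosure (D : Set (StrongDual ℝ X)) : D ⊆ weakStarClosure D :=
  fun _ hf => mem_weakStarClosure.2 (subset_closure (mem_image_of_mem _ hf))

lemma weakStarClosure_mono {D E : Set (StrongDual ℝ X)} (h : D ⊆ E) :
    weakStarClosure D ⊆ weakStarClosure E :=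
  fun _ hf => mem_weakStarClosure.2 (closure_mono (image_mono h) (mem_weakStarClosure.1 hf))

lemma weakStarClosure_idem (D : Set (StrongDual ℝ X)) :
    weakStarClosure (weakStarClosure D) ⊆ weakStarClosure D := by
  intro f hf
  have h : (StrongDual.toWeakDual : _ → WeakDual ℝ X) '' weakStarClosure D
      ⊆ closure ((StrongDual.toWeakDual : _ → WeakDual ℝ X) '' D) := by
    rintro _ ⟨g, hg, rfl⟩
    exact hg
  exact mem_weakStarClosure.2 (closure_minimal h isClosed_closure (mem_weakStarClosure.1 hf))

/-- A set of functionals is weak* closed as soon as it contains the pointwise limits of its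
elements along ultrafilters. -/
lemma weakStarClosure_subset_of_ultrafilter {D E : Set (StrongDual ℝ X)}
    (h : ∀ (u : Ultrafilter (StrongDual ℝ X)) (f : StrongDual ℝ X), D ∈ u →
      Tendsto (fun g => StrongDual.toWeakDual g) (u : Filter (StrongDual ℝ X))
        (𝓝 (StrongDual.toWeakDual f)) → f ∈ E) : weakStarClosure D ⊆ E := by
  intro f hf
  obtain ⟨u, hu, huf⟩ := mem_closure_iff_ultrafilter.1 (mem_weakStarClosure.1 hf)
  refine h (u.map WeakDual.toStrongDual) f ?_ huf
  refine Ultrafilter.mem_map.2 (Filter.mem_of_superset hu ?_)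
  rintro _ ⟨g, hg, rfl⟩
  exact hg

lemma convex_weakStarClosure {D : Set (StrongDual ℝ X)} (hD : Convex ℝ D) :
    Convex ℝ (weakStarClosure D) := by
  have h1 : Convex ℝ ((StrongDual.toWeakDual : _ → WeakDual ℝ X) '' D) :=
    hD.linear_image (StrongDual.toWeakDual : StrongDual ℝ X ≃ₗ[ℝ] WeakDual ℝ X).toLinearMap
  exact h1.closure.linear_preimage
    (StrongDual.toWeakDual : StrongDual ℝ X ≃ₗ[ℝ] WeakDual ℝ X).toLinearMap

/-- Weak* separation of a functional from a weak* closed convex set of functionals; the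
separating weak* continuous functional is evaluation at a point. -/
lemma exists_separating_point {D : Set (StrongDual ℝ X)} (hD : Convex ℝ D)
    (hcl : weakStarClosure D ⊆ D) {f : StrongDual ℝ X} (hf : f ∉ D) :
    ∃ (v : X) (c : ℝ), (∀ g ∈ D, g v < c) ∧ c < f v := by
  have h1 : Convex ℝ ((StrongDual.toWeakDual : _ → WeakDual ℝ X) '' D) :=
    hD.linear_image (StrongDual.toWeakDual : StrongDual ℝ X ≃ₗ[ℝ] WeakDual ℝ X).toLinearMap
  have : LocallyConvexSpace ℝ (WeakDual ℝ X) :=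
    inferInstanceAs (LocallyConvexSpace ℝ (WeakBilin (topDualPairing ℝ X)))
  obtain ⟨F, c, hF, hFf⟩ := geometric_hahn_banach_closed_point h1.closure isClosed_closure
    (x := StrongDual.toWeakDual f) (fun h => hf (hcl h))
  obtain ⟨v, hv⟩ := LinearMap.dualEmbedding_surjective (topDualPairing ℝ X) F
  have hev : ∀ g : StrongDual ℝ X, F (StrongDual.toWeakDual g) = g v := fun g => by
    rw [← hv]; rfl
  refine ⟨v, c, fun g hg => ?_, ?_⟩
  · rw [← hev]
    exact hF _ (subset_closure (mem_image_of_mem _ hg))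
  · rw [← hev]
    exact hFf

variable {A : X → Set (StrongDual ℝ X)}

/-! ### Values of maximally monotone operators and normal cones -/

lemma IsMonotone.apply_nonneg (hA : IsMonotone A) {x y : X} {f g : StrongDual ℝ X} (hf : f ∈ A x)
    (hg : g ∈ A y) : 0 ≤ (f - g) (x - y) :=
  hA (x, f) hf (y, g) hg

lemma IsMaximallyMonotone.mem_iff (hA : IsMaximallyMonotone A) {x : X} {f : StrongDual ℝ X} :
    f ∈ A x ↔ ∀ c, ∀ g ∈ A c, 0 ≤ (f - g) (x - c) := by
  refine ⟨fun hf c g hg => hA.1.apply_nonneg hf hg, fun h => ?_⟩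
  let B : X → Set (StrongDual ℝ X) := fun y => {g | g ∈ A y ∨ (y = x ∧ g = f)}
  have hB : B = A := by
    refine hA.2 B ?_ fun p hp => Or.inl hp
    rintro ⟨y, g⟩ (hp | ⟨hy, hg⟩) ⟨z, k⟩ (hq | ⟨hz, hk⟩)
    · exact hA.1 _ hp _ hq
    · dsimp only at hz hk ⊢
      subst hz hk
      have := h y g hp
      simp only [_root_.sub_apply, map_sub] at this ⊢
      linarith
    · dsimp only at hy hg ⊢
      subst hy hg
      exact h z k hq
    · simp_all
  rw [← hB]
  exact Or.inr ⟨rfl, rfl⟩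

lemma IsMaximallyMonotone.convex_apply (hA : IsMaximallyMonotone A) (x : X) :
    Convex ℝ (A x) := by
  intro f hf g hg a b ha hb hab
  rw [hA.mem_iff] at hf hg ⊢
  intro c k hk
  have h1 := hf c k hk
  have h2 := hg c k hk
  have h3 : (a • f + b • g - k) (x - c) = a * (f - k) (x - c) + b * (g - k) (x - c) := by
    have : b = 1 - a := by linarith
    subst this
    simp only [_root_.sub_apply, _root_.add_apply,
      _root_.smul_apply, smul_eq_mul]
    ring
  rw [h3]
  positivity

lemma IsMaximallyMonotone.weakStarClosure_subset (hA : IsMaximallyMonotone A) (x : X) :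
    weakStarClosure (A x) ⊆ A x := by
  refine weakStarClosure_subset_of_ultrafilter fun u f hu huf => ?_
  rw [hA.mem_iff]
  intro c g hg
  have h1 : Tendsto (fun k : StrongDual ℝ X => (k - g) (x - c)) u (𝓝 ((f - g) (x - c))) :=
    (tendsto_eval huf (x - c)).sub_const _
  refine ge_of_tendsto h1 ?_
  filter_upwards [hu] with k hk
  exact hA.1.apply_nonneg hk hg

lemma mem_normalCone_closure {C : Set X} {x : X} {n : StrongDual ℝ X}
    (hx : x ∈ closure C) (h : ∀ c ∈ C, n (c - x) ≤ 0) : n ∈ normalCone (closure C) x := by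
  refine ⟨hx, fun c hc => ?_⟩
  have : IsClosed {c | n (c - x) ≤ 0} := isClosed_le (by fun_prop) continuous_const
  exact closure_minimal h this hc

lemma convex_normalCone (C : Set X) (x : X) : Convex ℝ (normalCone C x) := by
  intro f hf g hg a b ha hb hab
  refine ⟨hf.1, fun c hc => ?_⟩
  have h1 := mul_nonpos_of_nonneg_of_nonpos ha (hf.2 c hc)
  have h2 := mul_nonpos_of_nonneg_of_nonpos hb (hg.2 c hc)
  simpa using add_nonpos h1 h2

lemma smul_mem_normalCone {C : Set X} {x : X} {n : StrongDual ℝ X} (hn : n ∈ normalCone C x)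
    {t : ℝ} (ht : 0 ≤ t) : t • n ∈ normalCone C x :=
  ⟨hn.1, fun c hc => by
    simpa only [_root_.smul_apply, smul_eq_mul] using
      mul_nonpos_of_nonneg_of_nonpos ht (hn.2 c hc)⟩

/-- Values of a maximally monotone operator absorb the normal cone of its domain. -/
lemma IsMaximallyMonotone.add_normalCone_mem (hA : IsMaximallyMonotone A) {x : X}
    {f n : StrongDual ℝ X} (hf : f ∈ A x) (hn : n ∈ normalCone (closure (dom A)) x) :
    n + f ∈ A x := by
  rw [hA.mem_iff]
  intro c g hg
  have h1 := hA.1.apply_nonneg hf hg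
  have h2 := hn.2 c (subset_closure ⟨g, hg⟩)
  have h3 : (n + f - g) (x - c) = -n (c - x) + (f - g) (x - c) := by
    simp only [_root_.sub_apply, _root_.add_apply, map_sub]
    ring
  rw [h3]
  linarith

/-! ### Points at which the graph grows linearly, and local boundedness -/

/-- The points `z` from which the graph of `A` is seen with linear growth at rate `K`:
`g (z - y) ≤ K (1 + ‖y‖)` for all `(y, g)` in the graph. These sets are closed and convex, they
increase with `K`, and by monotonicity their union contains the domain of `A`. -/
def growthSet (A : X → Set (StrongDual ℝ X)) (K : ℝ) : Set X :=
  {z | ∀ y, ∀ g ∈ A y, g (z - y) ≤ K * (1 + ‖y‖)}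

lemma growthSet_mono {K K' : ℝ} (h : K ≤ K') : growthSet A K ⊆ growthSet A K' :=
  fun _ hz y g hg => (hz y g hg).trans (by gcongr)

lemma isClosed_growthSet (K : ℝ) : IsClosed (growthSet A K) := by
  simp only [growthSet, ofPred_forall]
  exact isClosed_iInter fun y => isClosed_iInter fun g => isClosed_iInter fun _ =>
    isClosed_le (by fun_prop) continuous_const

lemma convex_growthSet (K : ℝ) : Convex ℝ (growthSet A K) := by
  intro z hz w hw a b ha hb hab y g hg
  have h1 := mul_le_mul_of_nonneg_left (hz y g hg) ha
  have h2 := mul_le_mul_of_nonneg_left (hw y g hg) hb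
  have h3 : a • z + b • w - y = a • (z - y) + b • (w - y) := by
    have : b = 1 - a := by linarith
    subst this
    module
  rw [h3, map_add, map_smul, map_smul, smul_eq_mul, smul_eq_mul]
  have h4 : a * (K * (1 + ‖y‖)) + b * (K * (1 + ‖y‖)) = K * (1 + ‖y‖) := by
    rw [← add_mul, hab, one_mul]
  linarith

lemma IsMonotone.exists_mem_growthSet (hA : IsMonotone A) {z : X} (hz : z ∈ dom A) :
    ∃ K, z ∈ growthSet A K := by
  obtain ⟨f, hf⟩ := hz
  refine ⟨‖f‖ * (1 + ‖z‖), fun y g hg => ?_⟩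
  have h1 := hA.apply_nonneg hf hg
  rw [_root_.sub_apply] at h1
  calc g (z - y) ≤ f (z - y) := by linarith
    _ ≤ ‖f‖ * ‖z - y‖ := (le_abs_self _).trans (f.le_opNorm _)
    _ ≤ ‖f‖ * (‖z‖ + ‖y‖) := by gcongr; exact norm_sub_le _ _
    _ ≤ ‖f‖ * ((1 + ‖z‖) * (1 + ‖y‖)) := by
        gcongr
        nlinarith [norm_nonneg z, norm_nonneg y]
    _ = _ := by ring

lemma IsMonotone.exists_mem_growthSet_of_mem_convexHull (hA : IsMonotone A) {z : X}
    (hz : z ∈ convexHull ℝ (dom A)) : ∃ K, z ∈ growthSet A K := by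
  have hc : Convex ℝ (⋃ K, growthSet A K) := by
    refine Directed.convex_iUnion ?_ fun K => convex_growthSet K
    exact directed_of_isDirected_le fun K K' h => growthSet_mono h
  have := convexHull_min (fun z hz => mem_iUnion.2 (hA.exists_mem_growthSet hz)) hc hz
  exact mem_iUnion.1 this

/-- Near a point that has a neighbourhood in a growth set, the operator is bounded. -/
lemma norm_le_of_ball_subset_growthSet {z : X} {δ K : ℝ} (hδ : 0 < δ) (hK : 0 ≤ K)
    (h : Metric.ball z δ ⊆ growthSet A K) {y : X} (hy : y ∈ Metric.ball z (δ / 2))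
    {g : StrongDual ℝ X} (hg : g ∈ A y) :
    ‖g‖ ≤ 2 * (K * (1 + (‖z‖ + δ))) / (δ / 2) := by
  rw [Metric.mem_ball, dist_eq_norm] at hy
  refine norm_le_of_forall_ball (by positivity) fun w hw => ?_
  have h1 : y + w ∈ Metric.ball z δ := by
    rw [Metric.mem_ball, dist_eq_norm]
    calc ‖y + w - z‖ = ‖(y - z) + w‖ := by congr 1; abel
      _ ≤ ‖y - z‖ + ‖w‖ := norm_add_le _ _
      _ < δ := by linarith
  have h2 := h h1 y g hg
  rw [add_sub_cancel_left] at h2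
  refine h2.trans ?_
  gcongr
  have : ‖y‖ ≤ ‖z‖ + ‖y - z‖ := by simpa using norm_add_le z (y - z)
  linarith

/-- Symmetrizing the double sum of `λᵢ λⱼ ⟨cᵢ - cⱼ, gᵢ - gⱼ⟩ ≥ 0`. -/
lemma IsMonotone.sum_apply_nonneg (hA : IsMonotone A) {ι : Type*} [Fintype ι] {w : ι → ℝ}
    {c : ι → X} {g : ι → StrongDual ℝ X} (hw : ∀ i, 0 ≤ w i) (hw1 : ∑ i, w i = 1)
    (hg : ∀ i, g i ∈ A (c i)) {y : X} (hy : ∑ i, w i • c i = y) :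
    0 ≤ ∑ i, w i * g i (c i - y) := by
  have h1 : 0 ≤ ∑ i, ∑ j, w i * w j * (g i - g j) (c i - c j) :=
    Finset.sum_nonneg fun i _ => Finset.sum_nonneg fun j _ =>
      mul_nonneg (mul_nonneg (hw i) (hw j)) (hA.apply_nonneg (hg i) (hg j))
  have h2 : ∀ i, ∑ j, w i * w j * g i (c i - c j) = w i * g i (c i - y) := by
    intro i
    have : c i - y = ∑ j, w j • (c i - c j) := by
      simp only [smul_sub, Finset.sum_sub_distrib, ← Finset.sum_smul, hw1, one_smul, hy]
    rw [this, map_sum, Finset.mul_sum]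
    refine Finset.sum_congr rfl fun j _ => ?_
    rw [map_smul, smul_eq_mul, mul_assoc]
  have h3 : ∑ i, ∑ j, w i * w j * (g i - g j) (c i - c j)
      = ∑ i, ∑ j, w i * w j * g i (c i - c j) + ∑ i, ∑ j, w j * w i * g j (c j - c i) := by
    rw [← Finset.sum_add_distrib]
    refine Finset.sum_congr rfl fun i _ => ?_
    rw [← Finset.sum_add_distrib]
    refine Finset.sum_congr rfl fun j _ => ?_
    simp only [_root_.sub_apply, map_sub]
    ring
  rw [Finset.sum_comm (f := fun i j => w j * w i * g j (c j - c i))] at h3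
  simp only [h2] at h3
  linarith

lemma exists_extension_of_mem_interior {C : Set X} {y : X} (hy : y ∈ interior C) (z : X) :
    ∃ ε > 0, y + (ε : ℝ) • (y - z) ∈ C := by
  have h1 : Tendsto (fun ε : ℝ => y + ε • (y - z)) (𝓝[>] 0) (𝓝 y) := by
    have : Continuous fun ε : ℝ => y + ε • (y - z) := by fun_prop
    simpa using (this.tendsto 0).mono_left nhdsWithin_le_nhds
  obtain ⟨ε, h, hε⟩ := ((h1.eventually (mem_interior_iff_mem_nhds.1 hy)).and
    self_mem_nhdsWithin).exists
  exact ⟨ε, hε, h⟩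

variable [CompleteSpace X]

/-- By the Baire category theorem, some interior point of the domain is interior to a growth
set. -/
lemma IsMonotone.exists_ball_subset_growthSet (hA : IsMonotone A)
    (hint : (interior (dom A)).Nonempty) :
    ∃ z δ K, 0 < δ ∧ 0 ≤ K ∧ Metric.ball z δ ⊆ dom A ∧ Metric.ball z δ ⊆ growthSet A K := by
  let F : Option ℕ → Set X := fun o => o.elim (interior (dom A))ᶜ fun n => growthSet A n
  have hF : ∀ o, IsClosed (F o) := by
    rintro (_ | n)
    · exact isOpen_interior.isClosed_compl
    · exact isClosed_growthSet _
  have hU : ⋃ o, F o = univ := by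
    refine eq_univ_of_forall fun z => mem_iUnion.2 ?_
    by_cases hz : z ∈ interior (dom A)
    · obtain ⟨K, hK⟩ := hA.exists_mem_growthSet (interior_subset hz)
      obtain ⟨n, hn⟩ := exists_nat_ge K
      exact ⟨some n, growthSet_mono hn hK⟩
    · exact ⟨none, hz⟩
  obtain ⟨z, hz, hzF⟩ :=
    (dense_iUnion_interior_of_closed hF hU).inter_open_nonempty _ isOpen_interior hint
  obtain ⟨o, ho⟩ := mem_iUnion.1 hzF
  cases o with
  | none => exact absurd hz (interior_subset ho)
  | some n =>
    obtain ⟨δ, hδ, hb⟩ := Metric.isOpen_iff.1 (isOpen_interior.inter isOpen_interior) z ⟨hz, ho⟩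
    exact ⟨z, δ, n, hδ, n.cast_nonneg, fun w hw => interior_subset (hb hw).1,
      fun w hw => interior_subset (hb hw).2⟩

/-- The growth estimate spreads by convexity from one ball to all interior points of the convex
hull of the domain. -/
lemma IsMonotone.exists_ball_subset_growthSet_of_mem_interior (hA : IsMonotone A)
    (hint : (interior (dom A)).Nonempty) {y : X} (hy : y ∈ interior (convexHull ℝ (dom A))) :
    ∃ δ K, 0 < δ ∧ 0 ≤ K ∧ Metric.ball y δ ⊆ growthSet A K := by
  obtain ⟨z, δ, K, hδ, hK, -, hb⟩ := hA.exists_ball_subset_growthSet hint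
  obtain ⟨ε, hε, hyε⟩ := exists_extension_of_mem_interior hy z
  obtain ⟨K', hK'⟩ := hA.exists_mem_growthSet_of_mem_convexHull hyε
  refine ⟨ε / (1 + ε) * δ, max K K', by positivity, le_max_of_le_left hK, fun w hw => ?_⟩
  -- `w` is a convex combination of `y + ε (y - z)` and of a point of the ball around `z`.
  have h1 : z + ((1 + ε) / ε) • (w - y) ∈ Metric.ball z δ := by
    rw [Metric.mem_ball, dist_eq_norm] at hw ⊢
    rw [add_sub_cancel_left, norm_smul, Real.norm_of_nonneg (by positivity)]
    calc (1 + ε) / ε * ‖w - y‖ < (1 + ε) / ε * (ε / (1 + ε) * δ) := by gcongr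
      _ = δ := by field_simp
  have h2 := convex_growthSet (A := A) (max K K') (growthSet_mono (le_max_right _ _) hK')
    (growthSet_mono (le_max_left _ _) (hb h1)) (a := 1 / (1 + ε)) (b := ε / (1 + ε))
    (by positivity) (by positivity) (by field_simp)
  convert h2 using 1
  have e1 : (ε / (1 + ε)) * ((1 + ε) / ε) = 1 := by field_simp
  have e2 : 1 / (1 + ε) = 1 - ε / (1 + ε) := by field_simp; ring
  have e3 : (1 / (1 + ε)) * ε = ε / (1 + ε) := by field_simp
  rw [smul_add, smul_add, smul_smul, smul_smul, e1, e3, e2]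
  module

/-! ### The interior of the domain is convex -/

/-- A maximally monotone operator is defined at interior points of the convex hull of its domain.
A value at `y` is a functional `f` with `f (c - y) ≤ g (c - y)` on the graph, which is
obtained by separating the convex hull of `{(c, r) | r > g (c - y)}` from `(y, 0)`. -/
lemma IsMaximallyMonotone.interior_convexHull_dom_subset (hA : IsMaximallyMonotone A)
    (hint : (interior (dom A)).Nonempty) : interior (convexHull ℝ (dom A)) ⊆ dom A := by
  intro y hy
  obtain ⟨z, δ, K, hδ, hK, hdom, hb⟩ := hA.1.exists_ball_subset_growthSet hint
  let G : Set (X × ℝ) := {q | ∃ g ∈ A q.1, g (q.1 - y) < q.2}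
  have hy0 : (y, (0 : ℝ)) ∉ convexHull ℝ G := by
    intro h
    obtain ⟨ι, _, w, q, hw, hw1, hq, hsum⟩ := mem_convexHull_iff_exists_fintype.1 h
    choose g hg hgr using hq
    have e1 : ∑ i, w i • (q i).1 = y := by
      simpa [Prod.fst_sum] using congrArg Prod.fst hsum
    have e2 : ∑ i, w i * (q i).2 = 0 := by
      simpa [Prod.snd_sum] using congrArg Prod.snd hsum
    have h1 := hA.1.sum_apply_nonneg hw hw1 hg e1
    obtain ⟨i, -, hi⟩ : ∃ i ∈ Finset.univ, 0 < w i := by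
      by_contra! hcon
      have := Finset.sum_nonpos hcon
      linarith
    have h2 : ∑ i, w i * g i ((q i).1 - y) < ∑ i, w i * (q i).2 :=
      Finset.sum_lt_sum (fun j _ => mul_le_mul_of_nonneg_left (hgr j).le (hw j))
        ⟨i, Finset.mem_univ i, mul_lt_mul_of_pos_left (hgr i) hi⟩
    linarith
  set M := 2 * (K * (1 + (‖z‖ + δ))) / (δ / 2) with hM
  have hM0 : 0 ≤ M := by positivity
  set R := M * (δ + ‖z - y‖) with hR
  have hbox : Metric.ball z (δ / 2) ×ˢ Ioi R ⊆ interior (convexHull ℝ G) := by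
    refine interior_maximal ?_ (Metric.isOpen_ball.prod isOpen_Ioi)
    rintro ⟨c, r⟩ ⟨hc, hr⟩
    refine subset_convexHull ℝ _ ?_
    obtain ⟨g, hg⟩ := hdom (Metric.ball_subset_ball (by linarith) hc)
    have h1 := norm_le_of_ball_subset_growthSet hδ hK hb hc hg
    refine ⟨g, hg, lt_of_le_of_lt ?_ hr⟩
    rw [Metric.mem_ball, dist_eq_norm] at hc
    have h2 : ‖c - y‖ ≤ δ + ‖z - y‖ := by
      have := norm_sub_le_norm_sub_add_norm_sub c z y
      linarith
    calc g (c - y) ≤ ‖g‖ * ‖c - y‖ := (le_abs_self _).trans (g.le_opNorm _)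
      _ ≤ M * (δ + ‖z - y‖) := by gcongr
  have hz : ∀ r, R < r → (z, r) ∈ interior (convexHull ℝ G) := fun r hr =>
    hbox ⟨Metric.mem_ball_self (by positivity), hr⟩
  obtain ⟨F, hF⟩ := geometric_hahn_banach_open_point (convex_convexHull ℝ G).interior
    isOpen_interior (fun h => hy0 (interior_subset h))
  have hFle : ∀ q ∈ G, F q ≤ F (y, 0) := by
    have hcl : closure (interior (convexHull ℝ G)) ⊆ {q | F q ≤ F (y, 0)} :=
      closure_minimal (fun q hq => (hF q hq).le) (isClosed_le F.continuous continuous_const)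
    rw [(convex_convexHull ℝ G).closure_interior_eq_closure_of_nonempty_interior
      ⟨_, hz (R + 1) (by linarith)⟩] at hcl
    exact fun q hq => hcl (subset_closure (subset_convexHull ℝ _ hq))
  let f : StrongDual ℝ X := F.comp (ContinuousLinearMap.inl ℝ X ℝ)
  let s : ℝ := F (0, 1)
  have hFs : ∀ v r, F (v, r) = f v + r * s := by
    intro v r
    have : (v, r) = (v, (0 : ℝ)) + r • ((0 : X), (1 : ℝ)) := by simp
    rw [this, map_add, map_smul, smul_eq_mul]
    rfl
  have hfy : F (y, 0) = f y := by rw [hFs]; ring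
  rw [hfy] at hF hFle
  have hs : s < 0 := by
    by_contra! hs
    rcases hs.eq_or_lt with hs | hs
    · -- A vertical separation would support the convex hull of the domain at the point `y`.
      have h1 : f z < f y := by
        have := hF _ (hz (R + 1) (by linarith))
        rwa [hFs, ← hs, mul_zero, add_zero] at this
      have h2 : convexHull ℝ (dom A) ⊆ {v | f v ≤ f y} := by
        refine convexHull_min ?_ (convex_halfSpace_le f.isLinear _)
        rintro c ⟨g, hg⟩
        have := hFle (c, g (c - y) + 1) ⟨g, hg, by simp⟩
        rwa [hFs, ← hs, mul_zero, add_zero] at this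
      obtain ⟨ε, hε, hyε⟩ := exists_extension_of_mem_interior hy z
      have h3 := h2 hyε
      simp only [mem_ofPred_eq, map_add, map_smul, map_sub, smul_eq_mul] at h3
      nlinarith
    · have h1 := hF _ (hz (max (R + 1) ((f y - f z) / s)) (lt_max_of_lt_left (by linarith)))
      rw [hFs] at h1
      have h2 : (f y - f z) / s * s ≤ max (R + 1) ((f y - f z) / s) * s := by
        gcongr
        exact le_max_right _ _
      rw [div_mul_cancel₀ _ hs.ne'] at h2
      linarith
  refine ⟨(-s)⁻¹ • f, hA.mem_iff.2 fun c g hg => ?_⟩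
  have h1 : f c + g (c - y) * s ≤ f y := by
    have h2 : ∀ r, g (c - y) < r → (f c - f y) / (-s) ≤ r := fun r hr => by
      have := hFle (c, r) ⟨g, hg, hr⟩
      rw [hFs] at this
      rw [div_le_iff₀ (by linarith)]
      linarith
    have h3 := le_of_forall_gt_imp_ge_of_dense h2
    rw [div_le_iff₀ (by linarith)] at h3
    linarith
  have h4 : ((-s)⁻¹ • f - g) (y - c) = (-s)⁻¹ * (f y - f c - g (c - y) * s) := by
    simp only [_root_.sub_apply, _root_.smul_apply, map_sub, smul_eq_mul]
    have := hs.ne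
    field_simp
    ring
  rw [h4]
  exact mul_nonneg (by rw [inv_nonneg]; linarith) (by linarith)

lemma IsMaximallyMonotone.interior_convexHull_dom (hA : IsMaximallyMonotone A)
    (hint : (interior (dom A)).Nonempty) :
    interior (convexHull ℝ (dom A)) = interior (dom A) :=
  (interior_maximal (hA.interior_convexHull_dom_subset hint) isOpen_interior).antisymm
    (interior_mono (subset_convexHull ℝ _))

lemma IsMaximallyMonotone.dom_subset_closure_interior (hA : IsMaximallyMonotone A)
    (hint : (interior (dom A)).Nonempty) : dom A ⊆ closure (interior (dom A)) := by
  have h := hA.interior_convexHull_dom hint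
  rw [← h, (convex_convexHull ℝ _).closure_interior_eq_closure_of_nonempty_interior (h ▸ hint)]
  exact (subset_convexHull ℝ _).trans subset_closure

end

section

variable {X : Type*} [NormedAddCommGroup X] [NormedSpace ℝ X] {A : X → Set (StrongDual ℝ X)}

/-! ### Feasible directions and the normal cone -/

/-- If every normal to an open convex set `U` at a point `x` of its closure is nonpositive in the
direction `v`, then perturbing `v` towards any point of `U` gives a direction that enters `U`. -/
lemma exists_add_smul_mem_of_normalCone_nonpos {U : Set X} (hU : IsOpen U) (hUc : Convex ℝ U)
    {x z v : X} (hx : x ∈ closure U) (hz : z ∈ U)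
    (hv : ∀ n ∈ normalCone (closure U) x, n v ≤ 0) {ε : ℝ} (hε : 0 < ε) :
    ∃ s > 0, x + (s : ℝ) • (v + ε • (z - x)) ∈ U := by
  by_contra! hcon
  set d := v + ε • (z - x) with hd
  have hray : Convex ℝ ((fun s : ℝ => x + s • d) '' Ioi 0) := by
    have h1 : (fun s : ℝ => x + s • d) '' Ioi 0
        = (fun y => x + y) '' ((fun s : ℝ => s • d) '' Ioi 0) := by rw [image_image]
    rw [h1]
    refine Convex.translate ?_ x
    exact (convex_Ioi 0).is_linear_image (IsLinearMap.isLinearMap_smul' d)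
  obtain ⟨g, c, hgU, hgr⟩ := geometric_hahn_banach_open hUc hU hray (by
    rw [Set.disjoint_left]
    rintro _ hyU ⟨s, hs, rfl⟩
    exact hcon s hs hyU)
  have hline : ∀ s : ℝ, 0 < s → c ≤ g x + s * g d := fun s hs => by
    simpa using hgr _ ⟨s, hs, rfl⟩
  have hcx : c ≤ g x := by
    have h1 : Tendsto (fun s : ℝ => g x + s * g d) (𝓝[>] 0) (𝓝 (g x)) := by
      have : Continuous fun s : ℝ => g x + s * g d := by fun_prop
      simpa using (this.tendsto 0).mono_left nhdsWithin_le_nhds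
    refine ge_of_tendsto h1 ?_
    filter_upwards [self_mem_nhdsWithin] with s hs using hline s hs
  have hgN : g ∈ normalCone (closure U) x :=
    mem_normalCone_closure hx fun u hu => by
      rw [map_sub]
      linarith [hgU u hu]
  have h1 := hv g hgN
  have h2 := hgU z hz
  have h3 : g d = g v + ε * (g z - g x) := by simp [hd]
  have h4 : g d < 0 := by nlinarith
  have h5 := hline ((g x - c + 1) / (-g d)) (div_pos (by linarith) (by linarith))
  have h6 : (g x - c + 1) / (-g d) * g d = -(g x - c + 1) := by
    have := h4.ne
    field_simp
  linarith

/-! ### Weak* closedness of the sum with the normal cone -/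

/-- The sum of the normal cone of the domain and a weak* closed subset of a value of `A` is
weak* closed: in the directions pointing to a ball in the domain, the normals are nonpositive and
the elements of `A x` are bounded above, so that the normals in a convergent net of sums stay
bounded. -/
lemma weakStarClosure_normalCone_add_subset {x z : X} {δ K : ℝ} (hδ : 0 < δ)
    (hdom : Metric.ball z δ ⊆ dom A) (hz : z ∈ growthSet A K)
    {E : Set (StrongDual ℝ X)} (hE : E ⊆ A x) (hEcl : weakStarClosure E ⊆ E) :
    weakStarClosure (normalCone (closure (dom A)) x + E)
      ⊆ normalCone (closure (dom A)) x + E := by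
  set N := normalCone (closure (dom A)) x with hN
  refine weakStarClosure_subset_of_ultrafilter fun u f hu huf => ?_
  have hdec : ∀ h : StrongDual ℝ X, ∃ n k : StrongDual ℝ X,
      h ∈ N + E → n ∈ N ∧ k ∈ E ∧ n + k = h := by
    intro h
    by_cases hh : h ∈ N + E
    · obtain ⟨n, hn, k, hk, rfl⟩ := Set.mem_add.1 hh
      exact ⟨n, k, fun _ => ⟨hn, hk, rfl⟩⟩
    · exact ⟨0, 0, fun h' => absurd h' hh⟩
  choose n k hnk using hdec
  have hev : ∀ᶠ h : StrongDual ℝ X in (u : Filter (StrongDual ℝ X)), f (z - x) - 1 < h (z - x) :=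
    (tendsto_eval huf (z - x)).eventually (lt_mem_nhds (sub_one_lt (f (z - x))))
  have hmem : ∀ᶠ h in (u : Filter (StrongDual ℝ X)), h ∈ N + E := hu
  have hbound : ∀ᶠ h in (u : Filter (StrongDual ℝ X)),
      ‖n h‖ ≤ 2 * (K * (1 + ‖x‖) - f (z - x) + 1) / δ := by
    filter_upwards [hmem, hev] with h hh hf
    obtain ⟨h1, h2, h3⟩ := hnk h hh
    refine norm_le_of_forall_ball hδ fun w hw => ?_
    have h4 : n h (z + w - x) ≤ 0 :=
      h1.2 _ (subset_closure (hdom (by simpa [Metric.mem_ball, dist_eq_norm] using hw)))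
    have h5 : k h (z - x) ≤ K * (1 + ‖x‖) := hz x _ (hE h2)
    have h6 : h (z - x) = n h (z - x) + k h (z - x) := by
      rw [← _root_.add_apply, h3]
    have h7 : n h (z + w - x) = n h (z - x) + n h w := by rw [← map_add]; congr 1; abel
    linarith
  obtain ⟨n₀, hn₀⟩ := exists_tendsto_of_bounded u hbound
  have hn₀N : n₀ ∈ N := by
    obtain ⟨h, hh⟩ := hmem.exists
    refine ⟨(hnk h hh).1.1, fun c hc => le_of_tendsto (tendsto_eval hn₀ (c - x)) ?_⟩
    filter_upwards [hmem] with h hh using (hnk h hh).1.2 c hc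
  have hk₀ : f - n₀ ∈ E := by
    refine hEcl (mem_weakStarClosure.2 <| mem_closure_of_tendsto (b := (u : Filter (StrongDual ℝ X)))
      (f := fun h => StrongDual.toWeakDual (k h)) ?_ ?_)
    · refine (huf.sub hn₀).congr' ?_
      filter_upwards [hmem] with h hh
      have := (hnk h hh).2.2
      rw [← map_sub]
      congr 1
      rw [sub_eq_iff_eq_add, add_comm, this]
    · filter_upwards [hmem] with h hh using mem_image_of_mem _ (hnk h hh).2.1
  exact Set.mem_add.2 ⟨n₀, hn₀N, f - n₀, hk₀, add_sub_cancel _ _⟩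

/-! ### The recession cone -/

lemma IsMaximallyMonotone.normalCone_subset_recessionCone (hA : IsMaximallyMonotone A) {x : X}
    (hx : x ∈ dom A) : normalCone (closure (dom A)) x ⊆ recessionCone A x := by
  intro n hn
  obtain ⟨f, hf⟩ := hx
  -- The functionals `(m + 1) n + f` lie in `A x`; scale them by `1 / (m + 1)`.
  refine ⟨fun m => 1 / ((m : ℝ) + 1), fun _ => x, fun m => ((m : ℝ) + 1) • n + f,
    fun m => Nat.one_div_pos_of_nat, tendsto_one_div_add_atTop_nhds_zero_nat,
    fun m => hA.add_normalCone_mem hf (smul_mem_normalCone hn (by positivity)),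
    tendsto_const_nhds, ?_⟩
  have h1 : Tendsto (fun m : ℕ => n + (1 / ((m : ℝ) + 1)) • f) atTop (𝓝 n) := by
    simpa using ((tendsto_one_div_add_atTop_nhds_zero_nat (𝕜 := ℝ)).smul_const f).const_add n
  refine ((NormedSpace.Dual.toWeakDual_continuous.tendsto n).comp h1).congr fun m => ?_
  have h2 : (m : ℝ) + 1 ≠ 0 := by positivity
  simp only [Function.comp_apply]
  congr 1
  rw [smul_add, smul_smul, one_div, inv_mul_cancel₀ h2, one_smul]

variable [CompleteSpace X]

lemma IsMonotone.recessionCone_subset_normalCone (hA : IsMonotone A) (x : X) :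
    recessionCone A x ⊆ normalCone (closure (dom A)) x := by
  rintro f ⟨t, a, g, ht, ht0, hg, ha, hf⟩
  refine mem_normalCone_closure
    (mem_closure_of_tendsto ha (Eventually.of_forall fun n => ⟨g n, hg n⟩)) ?_
  rintro c ⟨k, hk⟩
  obtain ⟨M, hM⟩ := banach_steinhaus (g := fun n => t n • g n) fun y => by
    obtain ⟨C, hC⟩ := (Metric.isBounded_range_of_tendsto _ (tendsto_eval hf y)).exists_norm_le
    exact ⟨C, fun n => hC _ ⟨n, rfl⟩⟩
  have h1 : Tendsto (fun n => (t n • g n) (c - a n)) atTop (𝓝 (f (c - x))) :=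
    tendsto_apply_of_bounded (Eventually.of_forall hM) (ha.const_sub c) (tendsto_eval hf (c - x))
  have h2 : Tendsto (fun n => t n * k (c - a n)) atTop (𝓝 (0 * k (c - x))) :=
    ht0.mul ((k.continuous.tendsto _).comp (ha.const_sub c))
  rw [zero_mul] at h2
  refine le_of_tendsto_of_tendsto' h1 h2 fun n => ?_
  have h3 := hA.apply_nonneg hk (hg n)
  rw [_root_.smul_apply, smul_eq_mul]
  refine mul_le_mul_of_nonneg_left ?_ (ht n).le
  rw [_root_.sub_apply] at h3
  linarith

/-! ### Closedness of the graph -/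

/-- The graph of a maximally monotone operator whose domain has interior points is closed for
norm × weak* convergence of nets, bounded or not. -/
lemma IsMaximallyMonotone.mem_of_tendsto (hA : IsMaximallyMonotone A)
    (hint : (interior (dom A)).Nonempty) {ι : Type*} {l : Filter ι} [l.NeBot] {y : ι → X}
    {φ : ι → StrongDual ℝ X} {x : X} {f : StrongDual ℝ X} (hmem : ∀ᶠ i in l, φ i ∈ A (y i))
    (hy : Tendsto y l (𝓝 x))
    (hφ : Tendsto (fun i => StrongDual.toWeakDual (φ i)) l (𝓝 (StrongDual.toWeakDual f))) :
    f ∈ A x := by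
  obtain ⟨z, δ, K, hδ, hK, -, hb⟩ := hA.1.exists_ball_subset_growthSet hint
  -- Testing against the points `z + w + (y i - x)` of the ball shows that `φ` is eventually bounded.
  have hbound : ∀ᶠ i in l, ‖φ i‖ ≤ 2 * (K * (1 + (‖x‖ + δ)) - f (z - x) + 1) / (δ / 2) := by
    have hev : ∀ᶠ i in l, f (z - x) - 1 < φ i (z - x) :=
      (tendsto_eval hφ (z - x)).eventually (lt_mem_nhds (sub_one_lt (f (z - x))))
    have hyx : ∀ᶠ i in l, y i ∈ Metric.ball x (δ / 2) :=
      hy.eventually (Metric.ball_mem_nhds x (by positivity))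
    filter_upwards [hmem, hev, hyx] with i hi hfi hyi
    rw [Metric.mem_ball, dist_eq_norm] at hyi
    refine norm_le_of_forall_ball (by positivity) fun w hw => ?_
    have h1 : z + w + (y i - x) ∈ Metric.ball z δ := by
      rw [Metric.mem_ball, dist_eq_norm]
      calc ‖z + w + (y i - x) - z‖ = ‖w + (y i - x)‖ := by congr 1; abel
        _ ≤ ‖w‖ + ‖y i - x‖ := norm_add_le _ _
        _ < δ := by linarith
    have h2 := hb h1 _ _ hi
    have h3 : φ i (z + w + (y i - x) - y i) = φ i (z - x) + φ i w := by
      rw [← map_add]; congr 1; abel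
    have h4 : K * (1 + ‖y i‖) ≤ K * (1 + (‖x‖ + δ)) := by
      have : ‖y i‖ ≤ ‖x‖ + ‖y i - x‖ := by simpa using norm_add_le x (y i - x)
      gcongr
      linarith
    linarith
  rw [hA.mem_iff]
  intro c g hg
  have h1 : Tendsto (fun i => φ i (y i - c)) l (𝓝 (f (x - c))) :=
    tendsto_apply_of_bounded hbound (hy.sub_const c) (tendsto_eval hφ (x - c))
  have h2 : Tendsto (fun i => g (y i - c)) l (𝓝 (g (x - c))) :=
    (g.continuous.tendsto _).comp (hy.sub_const c)
  refine ge_of_tendsto (h1.sub h2) ?_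
  filter_upwards [hmem] with i hi
  exact hA.1.apply_nonneg hi hg

lemma IsMaximallyMonotone.closedRestriction_subset (hA : IsMaximallyMonotone A)
    (hint : (interior (dom A)).Nonempty) (S : Set X) (x : X) :
    closedRestriction A S x ⊆ A x := by
  intro f hf
  obtain ⟨u, hu, huf⟩ := mem_closure_iff_ultrafilter.1
    (show (x, StrongDual.toWeakDual f) ∈ closure ((fun q : X × StrongDual ℝ X =>
      ((q.1, StrongDual.toWeakDual q.2) : X × WeakDual ℝ X)) '' (graph A ∩ (S ×ˢ univ))) from hf)
  have hu' : Tendsto id (u : Filter (X × WeakDual ℝ X)) (𝓝 (x, StrongDual.toWeakDual f)) := huf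
  refine hA.mem_of_tendsto hint (l := (u : Filter (X × WeakDual ℝ X))) (y := Prod.fst)
    (φ := fun q => WeakDual.toStrongDual q.2) ?_ hu'.fst_nhds hu'.snd_nhds
  filter_upwards [hu] with _ hq
  obtain ⟨q, hq, rfl⟩ := hq
  exact hq.1

/-! ### The closed restriction supports the operator in feasible directions -/

/-- In a direction `v` that enters the interior of the domain from `x`, the functionals in `A x` are
dominated by limits of values of `A` at points of `S` near the segment from `x` in the
direction `v`. -/
lemma IsMaximallyMonotone.exists_mem_closedRestriction (hA : IsMaximallyMonotone A) {S : Set X}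
    (hS : S ⊆ interior (dom A)) (hdense : interior (dom A) ⊆ closure S) {x v : X} {s₀ : ℝ}
    (hs₀ : 0 < s₀) (hv : x + s₀ • v ∈ interior (dom A)) {f : StrongDual ℝ X} (hf : f ∈ A x) :
    ∃ g ∈ closedRestriction A S x, f v ≤ g v := by
  have hint : (interior (dom A)).Nonempty := ⟨_, hv⟩
  have hUeq := hA.interior_convexHull_dom hint
  obtain ⟨δ, K, hδ, hK, hb⟩ :=
    hA.1.exists_ball_subset_growthSet_of_mem_interior hint (hUeq ▸ hv)
  let s : ℕ → ℝ := fun n => s₀ * (1 / ((n : ℝ) + 1))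
  have hs : ∀ n, 0 < s n := fun n => mul_pos hs₀ Nat.one_div_pos_of_nat
  have hss₀ : ∀ n, s n ≤ s₀ := fun n => by
    refine mul_le_of_le_one_right hs₀.le ?_
    rw [div_le_one (by positivity)]
    linarith [n.cast_nonneg (α := ℝ)]
  have hs0 : Tendsto s atTop (𝓝 0) := by
    simpa [s] using (tendsto_one_div_add_atTop_nhds_zero_nat (𝕜 := ℝ)).const_mul s₀
  have hex : ∀ n : ℕ, ∃ (v' : X) (g : StrongDual ℝ X), ‖v' - v‖ < 1 / ((n : ℝ) + 1) ∧
      x + s n • v' ∈ S ∧ g ∈ A (x + s n • v') := by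
    intro n
    have h1 : x + s n • v ∈ interior (dom A) := by
      have := (convex_convexHull ℝ (dom A)).add_smul_mem_interior
        (subset_convexHull ℝ _ ⟨f, hf⟩) (hUeq.symm ▸ hv) (t := 1 / ((n : ℝ) + 1))
        ⟨Nat.one_div_pos_of_nat, by
          rw [div_le_one (by positivity)]
          linarith [n.cast_nonneg (α := ℝ)]⟩
      rw [hUeq, smul_smul, mul_comm] at this
      exact this
    obtain ⟨y, hyS, hy⟩ := Metric.mem_closure_iff.1 (hdense h1) (s n * (1 / ((n : ℝ) + 1)))
      (mul_pos (hs n) Nat.one_div_pos_of_nat)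
    obtain ⟨g, hg⟩ := interior_subset (hS hyS)
    have hy' : x + s n • ((s n)⁻¹ • (y - x)) = y := by
      rw [smul_inv_smul₀ (hs n).ne']
      abel
    refine ⟨(s n)⁻¹ • (y - x), g, ?_, hy'.symm ▸ hyS, hy'.symm ▸ hg⟩
    have h2 : (s n)⁻¹ • (y - x) - v = (s n)⁻¹ • (y - (x + s n • v)) := by
      rw [← sub_sub, smul_sub _ (y - x), inv_smul_smul₀ (hs n).ne']
    rw [dist_comm, dist_eq_norm] at hy
    rw [h2, norm_smul, norm_inv, Real.norm_of_nonneg (hs n).le, inv_mul_lt_iff₀ (hs n)]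
    exact hy
  choose v' g hv' hvS hg using hex
  have hv'lim : Tendsto v' atTop (𝓝 v) := by
    rw [tendsto_iff_norm_sub_tendsto_zero]
    exact squeeze_zero (fun _ => norm_nonneg _) (fun n => (hv' n).le)
      tendsto_one_div_add_atTop_nhds_zero_nat
  have hylim : Tendsto (fun n => x + s n • v' n) atTop (𝓝 x) := by
    simpa using (hs0.smul hv'lim).const_add x
  have hmono : ∀ n, f (v' n) ≤ g n (v' n) := by
    intro n
    have h1 := hA.1.apply_nonneg (hg n) hf
    rw [add_sub_cancel_left, map_smul, smul_eq_mul, _root_.sub_apply] at h1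
    have := nonneg_of_mul_nonneg_right h1 (hs n)
    linarith
  have hbound : ∀ᶠ n in atTop,
      ‖g n‖ ≤ 2 * (K * (1 + (‖x‖ + 1)) + s₀ * |f v - 1|) / (δ / 2) := by
    have e1 : ∀ᶠ n in atTop, ‖s₀ • (v' n - v)‖ < δ / 2 := by
      have : Tendsto (fun n => ‖s₀ • (v' n - v)‖) atTop (𝓝 0) := by
        simpa using ((hv'lim.sub_const v).const_smul s₀).norm
      exact this.eventually (gt_mem_nhds (by positivity))
    have e2 : ∀ᶠ n in atTop, ‖x + s n • v' n‖ < ‖x‖ + 1 :=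
      hylim.norm.eventually (gt_mem_nhds (lt_add_one _))
    have e3 : ∀ᶠ n in atTop, f v - 1 < f (v' n) :=
      ((f.continuous.tendsto v).comp hv'lim).eventually (lt_mem_nhds (sub_one_lt (f v)))
    filter_upwards [e1, e2, e3] with n h1 h2 h3
    refine norm_le_of_forall_ball (by positivity) fun w hw => ?_
    have h4 : x + s₀ • v + (s₀ • (v' n - v) + w) ∈ Metric.ball (x + s₀ • v) δ := by
      rw [Metric.mem_ball, dist_eq_norm, add_sub_cancel_left]
      linarith [norm_add_le (s₀ • (v' n - v)) w]
    have h5 := hb h4 _ _ (hg n)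
    have h6 : x + s₀ • v + (s₀ • (v' n - v) + w) - (x + s n • v' n)
        = (s₀ - s n) • v' n + w := by module
    rw [h6, map_add, map_smul, smul_eq_mul] at h5
    have h7 : K * (1 + ‖x + s n • v' n‖) ≤ K * (1 + (‖x‖ + 1)) := by gcongr
    have h8 : -(s₀ * |f v - 1|) ≤ (s₀ - s n) * g n (v' n) := by
      have h9 : -|f v - 1| ≤ g n (v' n) := by linarith [neg_abs_le (f v - 1), hmono n]
      have h10 := mul_le_mul_of_nonneg_left h9 (sub_nonneg.2 (hss₀ n))
      have h11 := mul_nonneg (hs n).le (abs_nonneg (f v - 1))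
      linarith
    linarith
  have hu : ((hyperfilter ℕ : Ultrafilter ℕ) : Filter ℕ) ≤ atTop := Nat.hyperfilter_le_atTop
  obtain ⟨g₀, hg₀⟩ := exists_tendsto_of_bounded (hyperfilter ℕ) (hu hbound)
  refine ⟨g₀, ?_, ?_⟩
  · refine mem_closure_of_tendsto ((hylim.mono_left hu).prodMk_nhds hg₀) ?_
    exact Eventually.of_forall fun n => ⟨(x + s n • v' n, g n), ⟨hg n, hvS n, mem_univ _⟩, rfl⟩
  · exact le_of_tendsto_of_tendsto' (((f.continuous.tendsto v).comp hv'lim).mono_left hu)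
      (tendsto_apply_of_bounded (hu hbound) (hv'lim.mono_left hu) (tendsto_eval hg₀ v)) hmono

/-! ### The structure formula -/

lemma IsMaximallyMonotone.weakStarClosure_convexHull_closedRestriction_subset
    (hA : IsMaximallyMonotone A) (hint : (interior (dom A)).Nonempty) (S : Set X) (x : X) :
    weakStarClosure (convexHull ℝ (closedRestriction A S x)) ⊆ A x := by
  refine Subset.trans ?_ (hA.weakStarClosure_subset x)
  exact weakStarClosure_mono <|
    convexHull_min (hA.closedRestriction_subset hint S x) (hA.convex_apply x)

lemma IsMaximallyMonotone.eq_normalCone_add (hA : IsMaximallyMonotone A)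
    (hint : (interior (dom A)).Nonempty) {S : Set X} (hS : S ⊆ interior (dom A))
    (hdense : interior (dom A) ⊆ closure S) (x : X) :
    A x = normalCone (closure (dom A)) x
      + weakStarClosure (convexHull ℝ (closedRestriction A S x)) := by
  set N := normalCone (closure (dom A)) x with hN
  set E := weakStarClosure (convexHull ℝ (closedRestriction A S x)) with hE
  have hEA : E ⊆ A x := hA.weakStarClosure_convexHull_closedRestriction_subset hint S x
  have hSE : closedRestriction A S x ⊆ E :=
    (subset_convexHull ℝ _).trans (subset_weakStarClosure _)
  refine Subset.antisymm (fun f hf => ?_) ?_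
  swap
  · rintro _ ⟨n, hn, k, hk, rfl⟩
    exact hA.add_normalCone_mem (hEA hk) hn
  by_contra hfNE
  obtain ⟨z, δ, K, hδ, hK, hdom, hb⟩ := hA.1.exists_ball_subset_growthSet hint
  have hzK : z ∈ growthSet A K := hb (Metric.mem_ball_self hδ)
  have hzU : z ∈ interior (dom A) :=
    mem_interior_iff_mem_nhds.2 (mem_of_superset (Metric.ball_mem_nhds z hδ) hdom)
  obtain ⟨v, c, hlt, hfc⟩ := exists_separating_point
    ((convex_normalCone _ _).add (convex_weakStarClosure (convex_convexHull ℝ _)))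
    (weakStarClosure_normalCone_add_subset hδ hdom hzK hEA (weakStarClosure_idem _)) hfNE
  have hxD : x ∈ dom A := ⟨f, hf⟩
  have hxcl : x ∈ closure (dom A) := subset_closure hxD
  have hclU : closure (interior (dom A)) = closure (dom A) :=
    (closure_mono interior_subset).antisymm
      (closure_minimal (hA.dom_subset_closure_interior hint) isClosed_closure)
  have hUc : Convex ℝ (interior (dom A)) := by
    rw [← hA.interior_convexHull_dom hint]
    exact (convex_convexHull ℝ _).interior
  obtain ⟨k₀, hk₀, -⟩ := hA.exists_mem_closedRestriction hS hdense (x := x) (v := z - x)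
    one_pos (by simpa using hzU) hf
  have hNv : ∀ n ∈ N, n v ≤ 0 := by
    intro n hn
    by_contra! hpos
    have h1 := hlt _ (Set.add_mem_add
      (smul_mem_normalCone hn (t := |c - k₀ v| / n v) (by positivity)) (hSE hk₀))
    rw [_root_.add_apply, _root_.smul_apply, smul_eq_mul, div_mul_cancel₀ _ hpos.ne'] at h1
    linarith [le_abs_self (c - k₀ v)]
  have hzero : (0 : StrongDual ℝ X) ∈ N := ⟨hxcl, fun _ _ => by simp⟩
  have hkey : ∀ ε : ℝ, 0 < ε → f v - c ≤ ε * (K * (1 + ‖x‖) - f (z - x)) := by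
    intro ε hε
    obtain ⟨s, hs, hsU⟩ := exists_add_smul_mem_of_normalCone_nonpos isOpen_interior hUc
      (hclU.symm ▸ hxcl) hzU (by rw [hclU]; exact hNv) hε
    obtain ⟨g, hg, hfg⟩ := hA.exists_mem_closedRestriction hS hdense hs hsU hf
    have h1 : g v < c := by simpa using hlt _ (Set.add_mem_add hzero (hSE hg))
    have h2 : g (z - x) ≤ K * (1 + ‖x‖) := hzK x g (hEA (hSE hg))
    have h3 := mul_le_mul_of_nonneg_left h2 hε.le
    rw [map_add, map_add, map_smul, map_smul, smul_eq_mul, smul_eq_mul] at hfg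
    linarith
  have hlim : Tendsto (fun ε : ℝ => ε * (K * (1 + ‖x‖) - f (z - x))) (𝓝[>] 0) (𝓝 0) := by
    have : Continuous fun ε : ℝ => ε * (K * (1 + ‖x‖) - f (z - x)) := by fun_prop
    simpa using (this.tendsto 0).mono_left nhdsWithin_le_nhds
  have : f v - c ≤ 0 := by
    refine ge_of_tendsto hlim ?_
    filter_upwards [self_mem_nhdsWithin] with ε hε using hkey ε hε
  linarith

end

end SetValuedOp

theorem theorem4 {X : Type*} [NormedAddCommGroup X] [NormedSpace ℝ X] [CompleteSpace X]
    (A : X → Set (StrongDual ℝ X)) (hA : SetValuedOp.IsMaximallyMonotone A)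
    (hint : (interior (SetValuedOp.dom A)).Nonempty)
    (S : Set X) (hS : S ⊆ interior (SetValuedOp.dom A))
    (hdense : interior (SetValuedOp.dom A) ⊆ closure S) (x : X) :
    A x = SetValuedOp.normalCone (closure (SetValuedOp.dom A)) x
        + SetValuedOp.weakStarClosure (convexHull ℝ (SetValuedOp.closedRestriction A S x)) ∧
    A x = SetValuedOp.recessionCone A x
        + SetValuedOp.weakStarClosure (convexHull ℝ (SetValuedOp.closedRestriction A S x)) := by
  have h := hA.eq_normalCone_add hint hS hdense x
  refine ⟨h, ?_⟩
  by_cases hx : x ∈ SetValuedOp.dom A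
  · rw [(hA.1.recessionCone_subset_normalCone x).antisymm
      (hA.normalCone_subset_recessionCone hx)]
    exact h
  · -- Off the domain the second summand, being contained in `A x`, is empty.
    have hAx : A x = ∅ := Set.not_nonempty_iff_eq_empty.1 hx
    have hE := hA.weakStarClosure_convexHull_closedRestriction_subset hint S x
    rw [hAx, Set.subset_empty_iff] at hE
    rw [hE, hAx, Set.add_empty]
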